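/- Let $X,X_1,X_2,\dots$ be i.i.d. real random variables with distribution function $F(x)=\mathbb P(X\le x)$, let $t\in\mathbb R$, and for $n\ge 1$ let $T_{n;X,t}$ be the graph on $[n]$ in which distinct $i,j$ are adjacent iff $X_i+X_j>t$. Let $F^{-1}(u)=\sup\{x\in\mathbb R: F(x)\le u\}$ for $0<u\le 1$ (finite for $u<1$, and $F^{-1}(1)=\infty$), and let $$S=\{(x,y)\in(0,1]^2: F^{-1}(x)+F^{-1}(y)>t\},$$ viewed as a subset of $[0,1]^2$. For $n\ge1$ let $T_{n,S}$ be the random graph on $[n]$ in which $i<j$ are adjacent iff $(U_i,U_j)\in S$, where $U_1,\dots,U_n$ are independent and uniform on $[0,1]$. For a finite graph $G$ with $v(G)\ge 1$ vertices let $\nu(G)$ be the probability measure on $[0,1]$ that is the law of $d_G(v)/v(G)$ for a uniformly random vertex $v$ of $G$, and for a finite graph $K$ let $t(K,G)$ be the probability that a uniformly random map $V(K)\to V(G)$ is a graph homomorphism. For a symmetric measurable $W:[0,1]^2\to[0,1]$ put $t(K,W)=\int_{[0,1]^{V(K)}}\prod_{ij\in E(K)}W(x_i,x_j)\,dx$,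 and let the graph limit $\Gamma_W$ be the class of $W$ under the relation identifying functions with the same $t(K,\cdot)$ for all finite graphs $K$. We write $G_n\to\Gamma_W$ if $v(G_n)\to\infty$ and $t(K,G_n)\to t(K,W)$ for every finite graph $K$. For a probability measure $\mu$ on $[0,1]$ let $S_\mu=\{(x,y)\in[0,1]^2: x\ge\mu[0,1-y)\}$; call $\mu$ symmetric if $S_\mu$ is invariant under $(x,y)\mapsto(y,x)$, and in that case let $\Gamma_\mu=\Gamma_{W_\mu}$ with $W_\mu=\mathbf 1_{S_\mu}$. Then: 1. $S$ is symmetric and increasing (if $(x,y)\in S$, $x\le x'\le1$ and $y\le y'\le1$, then $(x',y')\in S$), and $T_{n;X,t}$ and $T_{n,S}$ have the same distribution (as labelled graphs) for every $n$. 2. Let $\mu$ be the distribution of $1-F(t-X)$, i.e. $\mu[0,s]=\mathbb P(1-F(t-X)\le s)$ for $s\in[0,1]$. Then almost surely $\nu(T_{n;X,t})\to\mu$ weakly as $n\to\infty$. 3. The measure $\mu$ is symmetric, and almost surely $T_{n;X,t}\to\Gamma_\mu$ as $n\to\infty$. -/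

import Mathlib

open MeasureTheory ProbabilityTheory Filter Topology
open scoped unitInterval ENNReal

noncomputable section

namespace ThresholdLimit

/-! ### Finite graphs: homomorphism densities and degree distributions -/

/-- The homomorphism density `t(F, G)`: the probability that a uniformly random map
`V(F) → V(G)` is a graph homomorphism. -/
def homDensity {k : ℕ} {V : Type*} [Fintype V] (F : SimpleGraph (Fin k)) (G : SimpleGraph V) : ℝ :=
  (Nat.card (F →g G) : ℝ) / (Fintype.card V : ℝ) ^ k

open Classical in
/-- The normalized degree `d_G(v) / v(G)`, an element of `[0,1]`. -/
def normDegree {V : Type*} [Fintype V] (G : SimpleGraph V) (v : V) : I :=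
  ⟨(G.degree v : ℝ) / Fintype.card V, by positivity,
    div_le_one_of_le₀ (by exact_mod_cast (G.degree_lt_card_verts v).le) (by positivity)⟩

/-- The (normalized) degree distribution `ν(G)`: the law of `d_G(v) / v(G)` for a uniformly
random vertex `v` of `G`. -/
def degreeDistribution {V : Type*} [Fintype V] [Nonempty V] (G : SimpleGraph V) :
    ProbabilityMeasure I :=
  ⟨(Fintype.card V : ℝ≥0∞)⁻¹ • ∑ v : V, Measure.dirac (normDegree G v), ⟨by
    simp [ENNReal.inv_mul_cancel]⟩⟩

/-! ### Graph limits -/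

/-- Symmetric measurable functions `W : [0,1]² → [0,1]`. -/
structure Graphon where
  /-- the underlying function -/
  toFun : I × I → I
  measurable' : Measurable toFun
  symm' : ∀ x y, toFun (x, y) = toFun (y, x)

open Classical in
/-- `t(F, W) = ∫ ∏_{ij ∈ E(F)} W(x_i, x_j) dx`; every edge `ij` of `F` is counted once, with
`i < j`. -/
def Graphon.homDensity {k : ℕ} (F : SimpleGraph (Fin k)) (W : Graphon) : ℝ :=
  ∫ x : Fin k → I,
    ∏ e ∈ Finset.univ.filter (fun e : Fin k × Fin k => e.1 < e.2 ∧ F.Adj e.1 e.2),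
      (W.toFun (x e.1, x e.2) : ℝ)

/-- Two functions represent the same graph limit iff all their homomorphism densities agree. -/
instance Graphon.setoid : Setoid Graphon where
  r W W' := ∀ (k : ℕ) (F : SimpleGraph (Fin k)), W.homDensity F = W'.homDensity F
  iseqv := ⟨fun _ _ _ => rfl, fun h k F => (h k F).symm, fun h h' k F => (h k F).trans (h' k F)⟩

/-- Graph limits: symmetric measurable functions `W : [0,1]² → [0,1]`, where functions with the
same homomorphism densities are identified. -/
def GraphLimit : Type := Quotient Graphon.setoid

/-- The graph limit `Γ_W` represented by `W`. -/
def GraphLimit.of (W : Graphon) : GraphLimit := Quotient.mk Graphon.setoid W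

/-- The functional `t(F, Γ)` on graph limits, with `t(F, Γ_W) = t(F, W)`. -/
def GraphLimit.homDensity {k : ℕ} (F : SimpleGraph (Fin k)) (Γ : GraphLimit) : ℝ :=
  Quotient.lift (s := Graphon.setoid) (fun W => W.homDensity F) (fun _ _ h => h k F) Γ

/-- `G_n → Γ` in the sense of graph limits: `v(G_n) → ∞`, and `t(F, G_n) → t(F, Γ)` for every
finite graph `F`. -/
def ConvergesTo {N : ℕ → ℕ} (G : ∀ n, SimpleGraph (Fin (N n))) (Γ : GraphLimit) : Prop :=
  Tendsto N atTop atTop ∧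
    ∀ (k : ℕ) (F : SimpleGraph (Fin k)),
      Tendsto (fun n => homDensity F (G n)) atTop (𝓝 (Γ.homDensity F))

/-! ### The graph limit defined by a symmetric probability measure on `[0,1]` -/

/-- `S_μ = {(x, y) ∈ [0,1]² : x ≥ μ [0, 1 - y)}`. -/
def limitSet (μ : ProbabilityMeasure I) : Set (I × I) :=
  {p | (μ (Set.Iio (σ p.2)) : ℝ) ≤ p.1}

/-- `μ` is symmetric: the set `S_μ` is invariant under reflection in the main diagonal. -/
def IsSymmetric (μ : ProbabilityMeasure I) : Prop :=
  Prod.swap ⁻¹' limitSet μ = limitSet μ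

lemma measurableSet_limitSet (μ : ProbabilityMeasure I) : MeasurableSet (limitSet μ) := by
  have h : Antitone (fun y : I => (μ (Set.Iio (σ y)) : ℝ)) := fun a b hab => by
    have : Set.Iio (σ b) ⊆ Set.Iio (σ a) := Set.Iio_subset_Iio (by
      simpa using hab)
    exact_mod_cast μ.apply_mono this
  exact measurableSet_le (h.measurable.comp measurable_snd)
    (measurable_subtype_coe.comp measurable_fst)

open Classical in
/-- `W_μ`, the indicator function of `S_μ`, for symmetric `μ`. -/
def limitGraphon (μ : ProbabilityMeasure I) (hμ : IsSymmetric μ) : Graphon where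
  toFun := fun p => if p ∈ limitSet μ then 1 else 0
  measurable' := Measurable.ite (measurableSet_limitSet μ) measurable_const measurable_const
  symm' := fun x y => by
    have h : (x, y) ∈ limitSet μ ↔ (y, x) ∈ limitSet μ := by
      conv_lhs => rw [← hμ]
      rfl
    simp only [h]

/-- The graph limit `Γ_μ` represented by `W_μ`. -/
def graphLimitOf (μ : ProbabilityMeasure I) (hμ : IsSymmetric μ) : GraphLimit :=
  GraphLimit.of (limitGraphon μ hμ)

/-! ### Two constructions of threshold graphs, as functions of the random input -/

/-- The threshold graph with vertex weights `w` and threshold `t`: distinct `i`, `j` are adjacent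
iff `w i + w j > t`. -/
def weightGraph {n : ℕ} (t : ℝ) (w : Fin n → ℝ) : SimpleGraph (Fin n) where
  Adj i j := i ≠ j ∧ w i + w j > t
  symm := ⟨fun i j h => ⟨h.1.symm, by rw [add_comm]; exact h.2⟩⟩
  loopless := ⟨fun _ h => h.1 rfl⟩

/-- The graph with an edge `ij`, for each pair `i < j`, iff `(u i, u j) ∈ S`. When `u 1, …, u n`
are independent and uniform on `[0,1]` this is the random graph `T_{n,S}`. -/
def setGraph {n : ℕ} (S : Set (I × I)) (u : Fin n → I) : SimpleGraph (Fin n) :=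
  SimpleGraph.fromRel (fun i j => i < j ∧ (u i, u j) ∈ S)

/-! ### Data attached to a weight distribution `ρ`, with distribution function `F = cdf ρ` -/

/-- The right-continuous inverse `F⁻¹(u) = sup {x : F(x) ≤ u}`, an extended real number
(finite for `0 < u < 1`, and `F⁻¹(1) = ∞`). -/
def quantile (ρ : Measure ℝ) (u : ℝ) : EReal :=
  sSup ((fun x : ℝ => (x : EReal)) '' {x : ℝ | cdf ρ x ≤ u})

/-- `S = {(x, y) ∈ (0,1]² : F⁻¹(x) + F⁻¹(y) > t}`. -/
def weightSet (ρ : Measure ℝ) (t : ℝ) : Set (I × I) :=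
  {p | 0 < p.1 ∧ 0 < p.2 ∧ quantile ρ p.1 + quantile ρ p.2 > (t : EReal)}

/-- The function `x ↦ 1 - F(t - x)`, with values in `[0,1]`. -/
def upperTail (ρ : Measure ℝ) (t x : ℝ) : I :=
  ⟨1 - cdf ρ (t - x), by linarith [cdf_le_one ρ (t - x)], by linarith [cdf_nonneg ρ (t - x)]⟩

lemma measurable_upperTail (ρ : Measure ℝ) (t : ℝ) : Measurable (upperTail ρ t) := by
  have h : Monotone (upperTail ρ t) := fun a b hab => by
    have := monotone_cdf ρ (show t - b ≤ t - a by linarith)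
    exact Subtype.mk_le_mk.2 (by linarith)
  exact h.measurable

/-- The law of `1 - F(t - X)`, where `X` has law `ρ`. -/
def tailLaw (ρ : Measure ℝ) [IsProbabilityMeasure ρ] (t : ℝ) : ProbabilityMeasure I :=
  ⟨ρ.map (upperTail ρ t),
    Measure.isProbabilityMeasure_map (measurable_upperTail ρ t).aemeasurable⟩

end ThresholdLimit

end

namespace ThresholdLimit

/-! Write `F = cdf ρ` and `q` for its quantile function. Since `q` carries the uniform law to `ρ`,
the weights may be replaced in law by `q (U i)`, and away from a null set `(x, y) ∈ S` means `q x +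
q y > t`. This gives the equality in law of the two graphs.

The almost sure statements are deterministic consequences of the uniform convergence of the
empirical distribution functions `F_n → F` (`glivenko_cantelli`), joined for the degrees with a
strong law. The normalized degree of `i` is `1 - F_n (t - X i)` up to one vertex, hence uniformly
close to `1 - F (t - X i)`, whose empirical law converges to `μ`. A homomorphism density is, up to
the vanishing share of non-injective maps, the mass that a power of the empirical measure gives to
the upper set `homSet`. Replacing the factors one at a time costs at most `sup |F_n - F|` each
(`abs_pi_real_sub_le_of_isUpperSet`).

The limiting mass is `t(K, W_μ)` because `(x, y) ∉ S_μ` iff some `z` has `x < F z` and `y < F (t -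
z)` (`notMem_limitSet_iff`). This condition is visibly symmetric, and almost everywhere it says `q x
+ q y ≤ t`. -/

/-- Inner regularity gives a compact subset of mass above `r`, and its maximum serves as `z`. Later
this treats open and closed rays at once. -/
lemma exists_mem_lt_cdf (ρ : Measure ℝ) [IsProbabilityMeasure ρ] {D : Set ℝ}
    (hD : MeasurableSet D) {r : ℝ} (hr : 0 ≤ r) (h : r < ρ.real D) : ∃ z ∈ D, r < cdf ρ z := by
  obtain ⟨K, hKD, hK, hKr⟩ := hD.exists_lt_isCompact (μ := ρ) (r := ENNReal.ofReal r)
    ((ENNReal.ofReal_lt_iff_lt_toReal hr (measure_ne_top _ _)).2 h)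
  have hne : K.Nonempty := by
    rw [Set.nonempty_iff_ne_empty]
    rintro rfl
    simp at hKr
  refine ⟨sSup K, hKD (hK.sSup_mem hne), ?_⟩
  rw [cdf_eq_real]
  exact ((ENNReal.ofReal_lt_iff_lt_toReal hr (measure_ne_top _ _)).1 hKr).trans_le
    (measureReal_mono fun k hk => le_csSup hK.bddAbove hk)

/-! ### The quantile function -/

section Quantile

variable (ρ : Measure ℝ)

lemma lt_quantile_iff {a u : ℝ} : (a : EReal) < quantile ρ u ↔ ∃ x, a < x ∧ cdf ρ x ≤ u := by
  simp only [quantile, lt_sSup_iff, Set.mem_image, Set.mem_ofPred_eq, exists_exists_and_eq_and,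
    EReal.coe_lt_coe_iff]
  exact ⟨fun ⟨x, h, h'⟩ => ⟨x, h', h⟩, fun ⟨x, h, h'⟩ => ⟨x, h', h⟩⟩

lemma cdf_le_of_lt_quantile {a u : ℝ} (h : (a : EReal) < quantile ρ u) : cdf ρ a ≤ u := by
  obtain ⟨x, hx, hu⟩ := (lt_quantile_iff ρ).1 h
  exact (monotone_cdf ρ hx.le).trans hu

lemma lt_quantile_of_cdf_lt {a u : ℝ} (h : cdf ρ a < u) : (a : EReal) < quantile ρ u := by
  have h1 : Tendsto (cdf ρ) (𝓝[>] a) (𝓝 (cdf ρ a)) :=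
    ((cdf ρ).right_continuous a).mono_left (nhdsWithin_mono _ Set.Ioi_subset_Ici_self)
  obtain ⟨x, hx, hax⟩ := ((h1.eventually_lt_const h).and self_mem_nhdsWithin).exists
  exact (lt_quantile_iff ρ).2 ⟨x, hax, hx.le⟩

lemma monotone_quantile : Monotone (quantile ρ) := fun _ _ h =>
  sSup_le_sSup (Set.image_mono fun _ hx => le_trans hx h)

lemma quantile_ne_bot {u : ℝ} (h : 0 < u) : quantile ρ u ≠ ⊥ := by
  obtain ⟨x, hx⟩ := ((tendsto_cdf_atBot ρ).eventually_lt_const h).exists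
  exact ((EReal.bot_lt_coe x).trans (lt_quantile_of_cdf_lt ρ hx)).ne'

lemma quantile_ne_top {u : ℝ} (h : u < 1) : quantile ρ u ≠ ⊤ := by
  obtain ⟨x, hx⟩ := ((tendsto_cdf_atTop ρ).eventually_const_lt h).exists
  intro htop
  have := cdf_le_of_lt_quantile ρ (a := x) (u := u) (by rw [htop]; exact EReal.coe_lt_top x)
  linarith

/-- The quantile function as a real-valued function (with junk value `0` where it is infinite). -/
noncomputable def realQuantile (u : I) : ℝ := (quantile ρ u).toReal

lemma coe_realQuantile {u : I} (h0 : 0 < u) (h1 : u < 1) :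
    (realQuantile ρ u : EReal) = quantile ρ u :=
  EReal.coe_toReal (quantile_ne_top ρ (by exact_mod_cast h1))
    (quantile_ne_bot ρ (by exact_mod_cast h0))

lemma measurable_realQuantile : Measurable (realQuantile ρ) :=
  (((monotone_quantile ρ).comp (Subtype.mono_coe _)).measurable).ereal_toReal

variable {ρ} in
lemma cdf_le_of_lt_realQuantile {a : ℝ} {u : I} (h0 : 0 < u) (h1 : u < 1)
    (h : a < realQuantile ρ u) : cdf ρ a ≤ u :=
  cdf_le_of_lt_quantile ρ (by rw [← coe_realQuantile ρ h0 h1]; exact_mod_cast h)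

variable {ρ} in
lemma lt_realQuantile_of_cdf_lt {a : ℝ} {u : I} (h0 : 0 < u) (h1 : u < 1)
    (h : cdf ρ a < u) : a < realQuantile ρ u := by
  have := lt_quantile_of_cdf_lt ρ h
  rw [← coe_realQuantile ρ h0 h1] at this
  exact_mod_cast this

variable {ρ} in
lemma le_cdf_of_realQuantile_le {a : ℝ} {u : I} (h0 : 0 < u) (h1 : u < 1)
    (h : realQuantile ρ u ≤ a) : (u : ℝ) ≤ cdf ρ a := by
  by_contra hlt
  exact (lt_realQuantile_of_cdf_lt h0 h1 (not_le.1 hlt)).not_ge h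

variable {ρ} in
lemma lt_cdf_of_realQuantile_lt {a : ℝ} {u : I} (h0 : 0 < u) (h1 : u < 1)
    (h : realQuantile ρ u < a) : (u : ℝ) < cdf ρ a := by
  by_contra! hle
  obtain ⟨b, hb, hba⟩ := exists_between h
  have := (lt_quantile_iff ρ).2 ⟨a, hba, hle⟩
  rw [← coe_realQuantile ρ h0 h1, EReal.coe_lt_coe_iff] at this
  exact this.not_gt hb

/-- The distribution function, as a function into `[0,1]`. -/
noncomputable def cdfI (x : ℝ) : I := ⟨cdf ρ x, cdf_nonneg ρ x, cdf_le_one ρ x⟩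

lemma measurable_cdfI : Measurable (cdfI ρ) :=
  (monotone_cdf ρ).measurable.subtype_mk

lemma ae_mem_Ioo_unitInterval : ∀ᵐ u : I, 0 < u ∧ u < 1 := by
  filter_upwards [Measure.ae_ne volume (0 : I), Measure.ae_ne volume (1 : I)] with u h0 h1
  exact ⟨unitInterval.pos_iff_ne_zero.2 h0, unitInterval.lt_one_iff_ne_one.2 h1⟩

/-- The events `q u ≤ a` and `u ≤ F a` can differ only at `u = 0`, `u = 1` and, when `F` is flat to
the right of `a`, at `u = F a`. -/
lemma measurePreserving_realQuantile [IsProbabilityMeasure ρ] :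
    MeasurePreserving (realQuantile ρ) volume ρ := by
  refine ⟨measurable_realQuantile ρ, ?_⟩
  have : IsProbabilityMeasure ((volume : Measure I).map (realQuantile ρ)) :=
    Measure.isProbabilityMeasure_map (measurable_realQuantile ρ).aemeasurable
  refine Measure.ext_of_Iic _ _ fun a => ?_
  rw [Measure.map_apply (measurable_realQuantile ρ) measurableSet_Iic, ← ofReal_cdf]
  have hae : realQuantile ρ ⁻¹' Set.Iic a =ᵐ[volume] Set.Iic (cdfI ρ a) := by
    filter_upwards [ae_mem_Ioo_unitInterval, Measure.ae_ne volume (cdfI ρ a)] with u hu hne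
    refine propext ⟨fun h => ?_, fun h => ?_⟩
    · by_contra hlt
      exact (lt_realQuantile_of_cdf_lt hu.1 hu.2 (a := a) (not_le.1 hlt)).not_ge h
    · by_contra hlt
      exact hne (le_antisymm h (cdf_le_of_lt_realQuantile hu.1 hu.2 (a := a) (not_le.1 hlt)))
  rw [measure_congr hae, unitInterval.volume_Iic]
  rfl

end Quantile

/-- Two coordinates are independent and uniform, and the graph of `g` has one-point sections. It is
used to discard the ties `x = F (t - q y)`. -/
lemma ae_apply_ne_comp_apply {ι : Type*} [Fintype ι] {a b : ι} (hab : a ≠ b) {g : I → I}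
    (hg : Measurable g) : ∀ᵐ u : ι → I, u a ≠ g (u b) := by
  have hind : IndepFun (fun u : ι → I => u a) (fun u => u b) volume :=
    (iIndepFun_pi (μ := fun _ : ι => (volume : Measure I)) (X := fun _ => id)
      fun _ => aemeasurable_id).indepFun hab
  have hmap : (volume : Measure (ι → I)).map (fun u => (u a, u b)) = volume.prod volume := by
    rw [(indepFun_iff_map_prod_eq_prod_map_map (measurable_pi_apply a).aemeasurable
      (measurable_pi_apply b).aemeasurable).1 hind]
    congr 1
    exacts [(measurePreserving_eval _ a).map_eq, (measurePreserving_eval _ b).map_eq]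
  have hm : MeasurableSet {p : I × I | p.1 = g p.2} :=
    measurableSet_eq_fun measurable_fst (hg.comp measurable_snd)
  have h0 : (volume.prod volume : Measure (I × I)) {p : I × I | p.1 = g p.2} = 0 := by
    rw [Measure.prod_apply_symm hm]
    simp [Set.preimage]
  rw [← hmap, Measure.map_apply (by fun_prop) hm] at h0
  exact measure_eq_zero_iff_ae_notMem.1 h0

/-! ### The sets `S` and `S_μ` -/

section LimitSets

variable (ρ : Measure ℝ) (t : ℝ)

lemma swap_preimage_weightSet : Prod.swap ⁻¹' weightSet ρ t = weightSet ρ t := by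
  ext ⟨x, y⟩
  simp only [weightSet, Set.mem_preimage, Set.mem_ofPred_eq, Prod.swap_prod_mk,
    add_comm (quantile ρ y)]
  tauto

lemma isUpperSet_weightSet : IsUpperSet (weightSet ρ t) := by
  rintro ⟨x, y⟩ ⟨x', y'⟩ ⟨h1, h2⟩ ⟨hx, hy, h⟩
  exact ⟨hx.trans_le h1, hy.trans_le h2,
    h.trans_le (add_le_add (monotone_quantile ρ h1) (monotone_quantile ρ h2))⟩

lemma mem_weightSet_iff {x y : I} (hx : 0 < x ∧ x < 1) (hy : 0 < y ∧ y < 1) :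
    (x, y) ∈ weightSet ρ t ↔ t < realQuantile ρ x + realQuantile ρ y := by
  simp only [weightSet, Set.mem_ofPred_eq, hx.1, hy.1, true_and, ← coe_realQuantile ρ hx.1 hx.2,
    ← coe_realQuantile ρ hy.1 hy.2, gt_iff_lt]
  exact_mod_cast Iff.rfl

variable [IsProbabilityMeasure ρ]

lemma tailLaw_Iio (y : I) :
    ((tailLaw ρ t) (Set.Iio (σ y)) : ℝ) = ρ.real {z | (y : ℝ) < cdf ρ (t - z)} := by
  change ((ρ.map (upperTail ρ t)) (Set.Iio (σ y))).toReal = _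
  rw [Measure.map_apply (measurable_upperTail ρ t) measurableSet_Iio, measureReal_def]
  congr 2
  ext z
  simp [upperTail, ← Subtype.coe_lt_coe]

/-- The set `{z | y < F (t - z)}` is a lower set, so its mass exceeds `x` exactly when `F` already
exceeds `x` at one of its points. The substitution `z ↦ t - z` then exchanges `x` and `y`. -/
lemma notMem_limitSet_iff (x y : I) :
    (x, y) ∉ limitSet (tailLaw ρ t) ↔ ∃ z, (x : ℝ) < cdf ρ z ∧ (y : ℝ) < cdf ρ (t - z) := by
  simp only [limitSet, Set.mem_ofPred_eq, tailLaw_Iio, not_le]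
  have hanti : Antitone fun z => cdf ρ (t - z) := fun a b h => monotone_cdf ρ (by linarith)
  refine ⟨fun h => ?_, fun ⟨z, hz, hz'⟩ => ?_⟩
  · obtain ⟨z, hz, hxz⟩ := exists_mem_lt_cdf ρ
      (measurableSet_lt measurable_const hanti.measurable) x.2.1 h
    exact ⟨z, hxz, hz⟩
  · rw [cdf_eq_real] at hz
    exact hz.trans_le (measureReal_mono fun w hw => hz'.trans_le (hanti hw))

lemma isSymmetric_tailLaw : IsSymmetric (tailLaw ρ t) := by
  ext ⟨x, y⟩
  rw [Set.mem_preimage, Prod.swap_prod_mk, ← not_iff_not, notMem_limitSet_iff,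
    notMem_limitSet_iff]
  constructor <;>
  · rintro ⟨z, h1, h2⟩
    exact ⟨t - z, h2, by simpa using h1⟩

lemma mem_limitSet_tailLaw_iff {x y : I} (hx : 0 < x ∧ x < 1) (hy : 0 < y ∧ y < 1)
    (hxy : x ≠ cdfI ρ (t - realQuantile ρ y)) (hyx : y ≠ cdfI ρ (t - realQuantile ρ x)) :
    (x, y) ∈ limitSet (tailLaw ρ t) ↔ t < realQuantile ρ x + realQuantile ρ y := by
  rw [← not_iff_not, notMem_limitSet_iff, not_lt]
  have hx' : (x : ℝ) ≠ cdf ρ (t - realQuantile ρ y) := fun h => hxy (Subtype.ext h)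
  have hy' : (y : ℝ) ≠ cdf ρ (t - realQuantile ρ x) := fun h => hyx (Subtype.ext h)
  refine ⟨fun ⟨z, hz, hz'⟩ => ?_, fun h => ?_⟩
  · have h1 : realQuantile ρ x ≤ z := by
      by_contra hlt
      exact hz.not_ge (cdf_le_of_lt_realQuantile hx.1 hx.2 (not_le.1 hlt))
    have h2 : realQuantile ρ y ≤ t - z := by
      by_contra hlt
      exact hz'.not_ge (cdf_le_of_lt_realQuantile hy.1 hy.2 (not_le.1 hlt))
    linarith
  · rcases h.lt_or_eq with hlt | heq
    · obtain ⟨z, hz, hz'⟩ := exists_between (lt_sub_iff_add_lt.2 hlt)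
      exact ⟨z, lt_cdf_of_realQuantile_lt hx.1 hx.2 hz,
        lt_cdf_of_realQuantile_lt hy.1 hy.2 (by linarith)⟩
    -- On the boundary the only candidate is `z = q x = t - q y`. There only weak inequalities are
    -- automatic, and excluding ties makes them strict.
    · refine ⟨t - realQuantile ρ y, lt_of_le_of_ne (le_cdf_of_realQuantile_le hx.1 hx.2
        (by linarith)) hx', lt_of_le_of_ne (le_cdf_of_realQuantile_le hy.1 hy.2 (by linarith)) ?_⟩
      rwa [show t - (t - realQuantile ρ y) = t - realQuantile ρ x by linarith]

lemma ae_mem_limitSet_tailLaw_iff {ι : Type*} [Fintype ι] :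
    ∀ᵐ u : ι → I, ∀ a b, a ≠ b → ((u a, u b) ∈ limitSet (tailLaw ρ t) ↔
      t < realQuantile ρ (u a) + realQuantile ρ (u b)) := by
  have hIoo : ∀ᵐ u : ι → I, ∀ a, 0 < u a ∧ u a < 1 := ae_all_iff.2 fun a =>
    (measurePreserving_eval (fun _ : ι => (volume : Measure I)) a).quasiMeasurePreserving.ae
      ae_mem_Ioo_unitInterval
  have hne : ∀ᵐ u : ι → I, ∀ a b, a ≠ b → u a ≠ cdfI ρ (t - realQuantile ρ (u b)) := by
    refine ae_all_iff.2 fun a => ae_all_iff.2 fun b => ?_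
    by_cases hab : a = b
    · exact ae_of_all _ fun u h => absurd hab h
    exact (ae_apply_ne_comp_apply hab ((measurable_cdfI ρ).comp
      (measurable_const.sub (measurable_realQuantile ρ)))).mono fun u hu _ => hu
  filter_upwards [hIoo, hne] with u h0 h1 a b hab
  exact mem_limitSet_tailLaw_iff ρ t (h0 a) (h0 b) (h1 a b hab) (h1 b a hab.symm)

end LimitSets

/-! ### Empirical measures -/

section Empirical

variable {V α : Type*} [Fintype V] [MeasurableSpace α]

/-- The empirical measure of a finite family of points. -/
noncomputable def empirical (w : V → α) : Measure α :=
  (Fintype.card V : ℝ≥0∞)⁻¹ • ∑ v : V, Measure.dirac (w v)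

instance [Nonempty V] (w : V → α) : IsProbabilityMeasure (empirical w) :=
  ⟨by simp [empirical, ENNReal.inv_mul_cancel]⟩

lemma empirical_apply (w : V → α) {s : Set α} (hs : MeasurableSet s) :
    empirical w s = (Fintype.card V : ℝ≥0∞)⁻¹ * ∑ v, s.indicator 1 (w v) := by
  simp [empirical, Measure.dirac_apply' _ hs]

lemma empirical_real_apply (w : V → α) {s : Set α} (hs : MeasurableSet s)
    [DecidablePred fun v => w v ∈ s] :
    (empirical w).real s = (Finset.univ.filter fun v => w v ∈ s).card / Fintype.card V := by
  rw [measureReal_def, empirical_apply w hs, ENNReal.toReal_mul, ENNReal.toReal_inv,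
    ENNReal.toReal_natCast, inv_mul_eq_div]
  congr 1
  rw [Finset.natCast_card_filter, ENNReal.toReal_sum fun v _ => by
    by_cases h : w v ∈ s <;> simp [h]]
  refine Finset.sum_congr rfl fun v _ => ?_
  by_cases h : w v ∈ s <;> simp [h]

lemma integral_empirical [Nonempty V] (w : V → α) {g : α → ℝ} (hg : StronglyMeasurable g) :
    ∫ x, g x ∂(empirical w) = (∑ v, g (w v)) / Fintype.card V := by
  rw [empirical, integral_smul_measure, integral_finsetSum_measure]
  · simp [integral_dirac' _ _ hg, inv_mul_eq_div]
  · intro v _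
    exact integrable_dirac' hg (by simp)

/-- A uniformly random map has independent uniform values; this turns counts of maps into product
measures. -/
lemma pi_empirical {ι : Type*} [Fintype ι] [DecidableEq ι] [Nonempty V] (w : V → α) :
    Measure.pi (fun _ : ι => empirical w) = empirical fun (f : ι → V) i => w (f i) := by
  refine Measure.pi_eq fun s hs => ?_
  simp only [empirical_apply w (hs _)]
  rw [empirical_apply _ (MeasurableSet.univ_pi hs), Finset.prod_mul_distrib,
    Finset.prod_const, Finset.prod_univ_sum, Fintype.card_fun, ← ENNReal.inv_pow]
  simp only [Nat.cast_pow, Finset.card_univ, Fintype.piFinset_univ]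
  congr 1
  refine Finset.sum_congr rfl fun f _ => ?_
  classical
  simp only [Set.indicator_apply, Pi.one_apply, Set.mem_univ_pi]
  rw [Finset.prod_boole]
  simp

end Empirical

/-! ### Measures of upper sets of measures with close distribution functions -/

section Discrepancy

lemma abs_real_sub_le_of_isLowerSet {μ ν : Measure ℝ} [IsProbabilityMeasure μ]
    [IsProbabilityMeasure ν] {ε : ℝ} (h : ∀ a, |cdf μ a - cdf ν a| ≤ ε) {L : Set ℝ}
    (hL : IsLowerSet L) : |μ.real L - ν.real L| ≤ ε := by
  -- The measures are quantified anew so that the one-sided bound can be applied in both orders.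
  have key : ∀ (μ ν : Measure ℝ) [IsProbabilityMeasure μ] [IsProbabilityMeasure ν],
      (∀ a, |cdf μ a - cdf ν a| ≤ ε) → μ.real L ≤ ν.real L + ε := by
    intro μ ν _ _ h
    have hε : 0 ≤ ε := (abs_nonneg _).trans (h 0)
    by_contra! hlt
    obtain ⟨z, hz, hz'⟩ := exists_mem_lt_cdf μ hL.ordConnected.measurableSet
      (by positivity) hlt
    have h1 : cdf ν z ≤ ν.real L := by
      rw [cdf_eq_real]
      exact measureReal_mono fun w hw => hL hw hz
    linarith [(abs_le.1 (h z)).2]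
  rw [abs_sub_le_iff]
  constructor
  · linarith [key μ ν h]
  · linarith [key ν μ fun a => by rw [abs_sub_comm]; exact h a]

lemma abs_real_sub_le_of_isUpperSet {μ ν : Measure ℝ} [IsProbabilityMeasure μ]
    [IsProbabilityMeasure ν] {ε : ℝ} (h : ∀ a, |cdf μ a - cdf ν a| ≤ ε) {A : Set ℝ}
    (hA : IsUpperSet A) : |μ.real A - ν.real A| ≤ ε := by
  have hm := hA.ordConnected.measurableSet
  have := abs_real_sub_le_of_isLowerSet h hA.compl
  rw [probReal_compl_eq_one_sub hm, probReal_compl_eq_one_sub hm] at this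
  rw [abs_sub_comm]
  convert this using 2
  ring

lemma prod_real_eq_integral_left {α β : Type*} [MeasurableSpace α] [MeasurableSpace β]
    {μ : Measure α} {M : Measure β} [IsFiniteMeasure M] {B : Set (α × β)}
    (hB : MeasurableSet B) : (μ.prod M).real B = ∫ x, M.real {y | (x, y) ∈ B} ∂μ := by
  rw [measureReal_def, Measure.prod_apply hB]
  exact (integral_toReal (measurable_measure_prodMk_left hB).aemeasurable
    (ae_of_all _ fun _ => measure_lt_top _ _)).symm

lemma prod_real_eq_integral_right {α β : Type*} [MeasurableSpace α] [MeasurableSpace β]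
    {μ : Measure α} {M : Measure β} [IsFiniteMeasure μ] [SFinite M] {B : Set (α × β)}
    (hB : MeasurableSet B) : (μ.prod M).real B = ∫ y, μ.real {x | (x, y) ∈ B} ∂M := by
  rw [measureReal_def, Measure.prod_apply_symm hB]
  exact (integral_toReal (measurable_measure_prodMk_right hB).aemeasurable
    (ae_of_all _ fun _ => measure_lt_top _ _)).symm

lemma abs_integral_sub_integral_le {α : Type*} [MeasurableSpace α] {μ : Measure α}
    [IsProbabilityMeasure μ] {f g : α → ℝ} (hf : Integrable f μ) (hg : Integrable g μ)
    {ε : ℝ} (h : ∀ x, |f x - g x| ≤ ε) :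
    |∫ x, f x ∂μ - ∫ x, g x ∂μ| ≤ ε := by
  rw [← integral_sub hf hg]
  simpa using norm_integral_le_of_norm_le_const (μ := μ) (f := fun x => f x - g x) (ae_of_all _ h)

lemma integrable_toReal_of_le_one {α : Type*} [MeasurableSpace α] {μ : Measure α}
    [IsFiniteMeasure μ] {f : α → ℝ≥0∞} (hf : Measurable f) (h : ∀ x, f x ≤ 1) :
    Integrable (fun x => (f x).toReal) μ :=
  .of_bound hf.ennreal_toReal.aestronglyMeasurable 1 (ae_of_all _ fun x => by
    simpa using ENNReal.toReal_mono ENNReal.one_ne_top (h x))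

/-- Pass through the hybrid `μ.prod N`: each half changes one factor, and Fubini reduces it to
sections. -/
lemma abs_prod_real_sub_le {α β : Type*} [MeasurableSpace α] [MeasurableSpace β]
    {μ ν : Measure α} [IsProbabilityMeasure μ] [IsProbabilityMeasure ν] {M N : Measure β}
    [IsProbabilityMeasure M] [IsProbabilityMeasure N] {B : Set (α × β)} (hB : MeasurableSet B)
    {ε δ : ℝ} (hε : ∀ y, |μ.real {x | (x, y) ∈ B} - ν.real {x | (x, y) ∈ B}| ≤ ε)
    (hδ : ∀ x, |M.real {y | (x, y) ∈ B} - N.real {y | (x, y) ∈ B}| ≤ δ) :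
    |(μ.prod M).real B - (ν.prod N).real B| ≤ δ + ε := by
  have h1 : |(μ.prod M).real B - (μ.prod N).real B| ≤ δ := by
    rw [prod_real_eq_integral_left hB, prod_real_eq_integral_left hB]
    exact abs_integral_sub_integral_le
      (integrable_toReal_of_le_one (measurable_measure_prodMk_left hB) fun _ => prob_le_one)
      (integrable_toReal_of_le_one (measurable_measure_prodMk_left hB) fun _ => prob_le_one) hδ
  have h2 : |(μ.prod N).real B - (ν.prod N).real B| ≤ ε := by
    rw [prod_real_eq_integral_right hB, prod_real_eq_integral_right hB]
    exact abs_integral_sub_integral_le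
      (integrable_toReal_of_le_one (measurable_measure_prodMk_right hB) fun _ => prob_le_one)
      (integrable_toReal_of_le_one (measurable_measure_prodMk_right hB) fun _ => prob_le_one) hε
  exact (abs_sub_le _ _ _).trans (add_le_add h1 h2)

/-- Sections of an upper set are upper sets, so induction splits off one coordinate at a cost of
`ε`. -/
lemma abs_pi_real_sub_le_of_isUpperSet {μ ν : Measure ℝ} [IsProbabilityMeasure μ]
    [IsProbabilityMeasure ν] {ε : ℝ} (h : ∀ a, |cdf μ a - cdf ν a| ≤ ε) {k : ℕ}
    {A : Set (Fin k → ℝ)} (hm : MeasurableSet A) (hA : IsUpperSet A) :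
    |(Measure.pi fun _ => μ).real A - (Measure.pi fun _ => ν).real A| ≤ k * ε := by
  induction k with
  | zero =>
    rcases A.eq_empty_or_nonempty with rfl | hne
    · simp
    · simp [Subsingleton.eq_univ_of_nonempty hne]
  | succ k ih =>
    let e := MeasurableEquiv.piFinSuccAbove (fun _ : Fin (k + 1) => ℝ) 0
    have hpi : ∀ (μ : Measure ℝ) [IsProbabilityMeasure μ],
        (Measure.pi fun _ : Fin (k + 1) => μ).real A =
          (μ.prod (Measure.pi fun _ : Fin k => μ)).real (e.symm ⁻¹' A) := by
      intro μ _
      have := (measurePreserving_piFinSuccAbove (fun _ : Fin (k + 1) => μ) 0).symm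
      rw [measureReal_def, measureReal_def, this.measure_preimage_equiv]
    have hcons : ∀ x y, e.symm (x, y) = Fin.cons x y := fun x y => by
      simp [e, MeasurableEquiv.piFinSuccAbove, Fin.consEquiv]
    have hB : MeasurableSet (e.symm ⁻¹' A) := e.symm.measurable hm
    rw [hpi μ, hpi ν, Nat.cast_succ, add_mul, one_mul]
    refine abs_prod_real_sub_le hB (fun y => ?_) fun x => ?_
    · refine abs_real_sub_le_of_isUpperSet h fun a b hab ha => ?_
      simp only [Set.mem_preimage, Set.mem_ofPred_eq, hcons] at ha ⊢
      exact hA (Fin.cons_le_cons.2 ⟨hab, le_rfl⟩) ha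
    · refine ih (measurable_prodMk_left hB) fun a b hab ha => ?_
      simp only [Set.mem_preimage, Set.mem_ofPred_eq, hcons] at ha ⊢
      exact hA (Fin.cons_le_cons.2 ⟨le_rfl, hab⟩) ha

end Discrepancy

/-! ### The Glivenko–Cantelli theorem -/

section GlivenkoCantelli

variable {Ω : Type*} [MeasurableSpace Ω] {P : Measure Ω} {ρ : Measure ℝ} {X : ℕ → Ω → ℝ}

lemma ae_tendsto_integral_empirical [IsProbabilityMeasure ρ] (hlaw : ∀ i, HasLaw (X i) ρ P)
    (hindep : iIndepFun X P) {g : ℝ → ℝ} (hg : Measurable g) {C : ℝ} (hC : ∀ x, |g x| ≤ C) :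
    ∀ᵐ ω ∂P, Tendsto (fun n : ℕ => ∫ x, g x ∂(empirical fun i : Fin (n + 1) => X i ω)) atTop
      (𝓝 (∫ x, g x ∂ρ)) := by
  have hint : Integrable g ρ := .of_bound hg.aestronglyMeasurable C (ae_of_all _ hC)
  have hident : ∀ i, IdentDistrib (X i) (X 0) P P := fun i =>
    ⟨(hlaw i).aemeasurable, (hlaw 0).aemeasurable, (hlaw i).map_eq.trans (hlaw 0).map_eq.symm⟩
  have hexp : P[fun ω => g (X 0 ω)] = ∫ x, g x ∂ρ :=
    (hlaw 0).integral_comp hg.aestronglyMeasurable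
  have hslln := strong_law_ae_real (fun i ω => g (X i ω))
    (by
      rw [← (hlaw 0).map_eq] at hint
      exact hint.comp_aemeasurable (hlaw 0).aemeasurable)
    (fun i j hij => (hindep.indepFun hij).comp hg hg) fun i => (hident i).comp hg
  filter_upwards [hslln] with ω hω
  rw [hexp] at hω
  refine (hω.comp (tendsto_add_atTop_nat 1)).congr fun n => ?_
  rw [integral_empirical _ hg.stronglyMeasurable]
  simp [Finset.sum_range]

lemma ae_tendsto_empirical_real [IsProbabilityMeasure ρ] (hlaw : ∀ i, HasLaw (X i) ρ P)
    (hindep : iIndepFun X P) {s : Set ℝ} (hs : MeasurableSet s) :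
    ∀ᵐ ω ∂P, Tendsto (fun n : ℕ => (empirical fun i : Fin (n + 1) => X i ω).real s) atTop
      (𝓝 (ρ.real s)) := by
  have := ae_tendsto_integral_empirical hlaw hindep (g := s.indicator 1)
    (measurable_one.indicator hs) (C := 1) fun x => by
      by_cases hx : x ∈ s <;> simp [hx]
  simpa only [integral_indicator_one hs] using this

lemma real_Iio_realQuantile_le [IsProbabilityMeasure ρ] {u : I} (h0 : 0 < u) (h1 : u < 1) :
    ρ.real (Set.Iio (realQuantile ρ u)) ≤ u := by
  by_contra! hlt
  obtain ⟨z, hz, hz'⟩ := exists_mem_lt_cdf ρ measurableSet_Iio u.2.1 hlt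
  exact hz'.not_ge (cdf_le_of_lt_realQuantile h0 h1 hz)

lemma exists_nat_div_mem_Ioo {m : ℕ} (hm : 0 < m) {a b : ℝ} (ha : 0 ≤ a) (hb : b ≤ 1)
    (hab : a + 1 / m < b) : ∃ j ≤ m, a < (j : ℝ) / m ∧ (j : ℝ) / m < b := by
  have hm' : (0 : ℝ) < m := by exact_mod_cast hm
  have h1 := Nat.lt_floor_add_one (a * m)
  have h2 := Nat.floor_le (a := a * m) (by positivity)
  have h3 : ((⌊a * m⌋₊ + 1 : ℕ) : ℝ) / m < b := by
    push_cast
    calc (⌊a * m⌋₊ + 1 : ℝ) / m ≤ (a * m + 1) / m := by gcongr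
      _ = a + 1 / m := by field_simp
      _ < b := hab
  -- This is the first grid point strictly beyond `a`.
  refine ⟨⌊a * m⌋₊ + 1, ?_, ?_, h3⟩
  · have := (div_lt_one hm').1 (h3.trans_le hb)
    exact_mod_cast this.le
  · rw [lt_div_iff₀ hm']
    push_cast
    exact h1

/-- Convergence of the distribution functions is uniform as soon as the measures of the two
rays ending at each rational quantile converge. -/
lemma eventually_forall_abs_cdf_sub_le [IsProbabilityMeasure ρ] {μ : ℕ → Measure ℝ}
    [∀ n, IsProbabilityMeasure (μ n)]
    (hIic : ∀ r : ℚ, Tendsto (fun n => (μ n).real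
      (Set.Iic (realQuantile ρ (Set.projIcc 0 1 zero_le_one r)))) atTop
      (𝓝 (ρ.real (Set.Iic (realQuantile ρ (Set.projIcc 0 1 zero_le_one r))))))
    (hIio : ∀ r : ℚ, Tendsto (fun n => (μ n).real
      (Set.Iio (realQuantile ρ (Set.projIcc 0 1 zero_le_one r)))) atTop
      (𝓝 (ρ.real (Set.Iio (realQuantile ρ (Set.projIcc 0 1 zero_le_one r))))))
    {ε : ℝ} (hε : 0 < ε) : ∀ᶠ n in atTop, ∀ a, |cdf (μ n) a - cdf ρ a| ≤ ε := by
  obtain ⟨m, hm⟩ := exists_nat_one_div_lt (half_pos hε)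
  have hfin : ∀ᶠ n in atTop, ∀ j ∈ Finset.range (m + 2),
      |(μ n).real (Set.Iic (realQuantile ρ (Set.projIcc 0 1 zero_le_one (j / (m + 1 : ℕ) : ℚ))))
        - ρ.real (Set.Iic (realQuantile ρ (Set.projIcc 0 1 zero_le_one (j / (m + 1 : ℕ) : ℚ))))|
        < ε / 2 ∧
      |(μ n).real (Set.Iio (realQuantile ρ (Set.projIcc 0 1 zero_le_one (j / (m + 1 : ℕ) : ℚ))))
        - ρ.real (Set.Iio (realQuantile ρ (Set.projIcc 0 1 zero_le_one (j / (m + 1 : ℕ) : ℚ))))|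
        < ε / 2 := by
    refine (Finset.eventually_all _).2 fun j _ => ?_
    exact ((Metric.tendsto_nhds.1 (hIic _)) _ (half_pos hε)).and
      ((Metric.tendsto_nhds.1 (hIio _)) _ (half_pos hε))
  filter_upwards [hfin] with n hn a
  have hgrid : ∀ b c : ℝ, 0 ≤ b → c ≤ 1 → b + ε / 2 ≤ c → ∃ u : I, 0 < u ∧ u < 1 ∧ b < u ∧ u < c ∧
      |(μ n).real (Set.Iic (realQuantile ρ u)) - ρ.real (Set.Iic (realQuantile ρ u))| < ε / 2 ∧
      |(μ n).real (Set.Iio (realQuantile ρ u)) - ρ.real (Set.Iio (realQuantile ρ u))|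
        < ε / 2 := by
    intro b c hb hc hbc
    obtain ⟨j, hj, hbj, hjc⟩ := exists_nat_div_mem_Ioo m.succ_pos hb hc
      (by push_cast; linarith)
    have hmem : (j : ℝ) / (m + 1 : ℕ) ∈ Set.Icc (0 : ℝ) 1 :=
      ⟨by positivity, (hjc.trans_le hc).le⟩
    have := hn j (Finset.mem_range.2 (by omega))
    have hcast : ((j / (m + 1 : ℕ) : ℚ) : ℝ) = (j : ℝ) / (m + 1 : ℕ) := by push_cast; rfl
    rw [hcast, Set.projIcc_of_mem zero_le_one hmem] at this
    exact ⟨⟨_, hmem⟩, Subtype.mk_lt_mk.2 (hb.trans_lt hbj), Subtype.mk_lt_mk.2 (hjc.trans_le hc),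
      hbj, hjc, this⟩
  have hF0 := cdf_nonneg ρ a
  have hF1 := cdf_le_one ρ a
  rw [abs_sub_le_iff]
  constructor
  -- Near the top the bound is trivial; otherwise a grid level fits above `F a`. The open ray is
  -- needed here: an atom at `q u` can push the closed ray's mass far above `u`.
  · by_cases hcase : 1 - ε ≤ cdf ρ a
    · linarith [cdf_le_one (μ n) a]
    · obtain ⟨u, h0, h1, hau, hua, -, hu⟩ := hgrid (cdf ρ a) (cdf ρ a + ε / 2) hF0
        (by linarith) le_rfl
      have hlt := lt_realQuantile_of_cdf_lt h0 h1 hau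
      have hle : cdf (μ n) a ≤ (μ n).real (Set.Iio (realQuantile ρ u)) := by
        rw [cdf_eq_real]
        exact measureReal_mono fun w hw => lt_of_le_of_lt hw hlt
      linarith [(abs_lt.1 hu).2, real_Iio_realQuantile_le (ρ := ρ) h0 h1]
  -- The mirror case takes a level below `F a` and the closed ray, whose mass is at least `u`.
  · by_cases hcase : cdf ρ a ≤ ε
    · linarith [cdf_nonneg (μ n) a]
    · obtain ⟨u, h0, h1, hau, hua, hu, -⟩ := hgrid (cdf ρ a - ε / 2) (cdf ρ a)
        (by linarith) hF1 (by linarith)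
      have hle : realQuantile ρ u ≤ a := by
        by_contra! hlt
        exact hua.not_ge (cdf_le_of_lt_realQuantile h0 h1 hlt)
      have h2 : (μ n).real (Set.Iic (realQuantile ρ u)) ≤ cdf (μ n) a := by
        rw [cdf_eq_real]
        exact measureReal_mono (Set.Iic_subset_Iic.2 hle)
      have h3 := le_cdf_of_realQuantile_le (ρ := ρ) h0 h1 le_rfl
      rw [cdf_eq_real] at h3
      linarith [(abs_lt.1 hu).1]

/-- The **Glivenko–Cantelli theorem**. -/
theorem glivenko_cantelli [IsProbabilityMeasure ρ] (hlaw : ∀ i, HasLaw (X i) ρ P)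
    (hindep : iIndepFun X P) :
    ∀ᵐ ω ∂P, ∀ ε > 0, ∀ᶠ n : ℕ in atTop, ∀ a,
      |cdf (empirical fun i : Fin (n + 1) => X i ω) a - cdf ρ a| ≤ ε := by
  -- Rational levels are countable and serve every `ε`, so a single null set suffices.
  have h1 := ae_all_iff.2 fun r : ℚ => ae_tendsto_empirical_real hlaw hindep
    (measurableSet_Iic (a := realQuantile ρ (Set.projIcc 0 1 zero_le_one r)))
  have h2 := ae_all_iff.2 fun r : ℚ => ae_tendsto_empirical_real hlaw hindep
    (measurableSet_Iio (a := realQuantile ρ (Set.projIcc 0 1 zero_le_one r)))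
  filter_upwards [h1, h2] with ω hω1 hω2 ε hε
  exact eventually_forall_abs_cdf_sub_le hω1 hω2 hε

end GlivenkoCantelli

/-! ### Degrees -/

section Degrees

/-- The two counts differ at most by the vertex `i` itself, which the empirical measure includes
when `2 * w i > t`. -/
lemma abs_normDegree_sub_le {n : ℕ} (t : ℝ) (w : Fin (n + 1) → ℝ) (i : Fin (n + 1)) :
    |(normDegree (weightGraph t w) i : ℝ) - (1 - cdf (empirical w) (t - w i))|
      ≤ 1 / (n + 1 : ℝ) := by
  classical
  rw [cdf_eq_real, ← probReal_compl_eq_one_sub measurableSet_Iic, Set.compl_Iic,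
    empirical_real_apply w measurableSet_Ioi]
  have hdeg : (normDegree (weightGraph t w) i : ℝ) =
      (Finset.univ.filter fun j => i ≠ j ∧ w i + w j > t).card / (n + 1 : ℝ) := by
    simp only [normDegree, Fintype.card_fin, Nat.cast_add, Nat.cast_one]
    congr 2
    rw [← SimpleGraph.card_neighborFinset_eq_degree, SimpleGraph.neighborFinset_eq_filter]
    congr 1
    ext j
    simp [weightGraph]
  have h1 : (Finset.univ.filter fun j => i ≠ j ∧ w i + w j > t).card ≤
      (Finset.univ.filter fun j => w j ∈ Set.Ioi (t - w i)).card :=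
    Finset.card_le_card fun j => by
      simp only [Finset.mem_filter, Finset.mem_univ, true_and, Set.mem_Ioi]
      exact fun h => by linarith [h.2]
  have h2 : (Finset.univ.filter fun j => w j ∈ Set.Ioi (t - w i)).card ≤
      (Finset.univ.filter fun j => i ≠ j ∧ w i + w j > t).card + 1 := by
    refine (Finset.card_le_card fun j => ?_).trans (Finset.card_insert_le i _)
    simp only [Finset.mem_filter, Finset.mem_univ, true_and, Set.mem_Ioi, Finset.mem_insert]
    intro h
    by_cases hij : i = j
    · exact Or.inl hij.symm
    · exact Or.inr ⟨hij, by linarith⟩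
  have h1' : ((Finset.univ.filter fun j => i ≠ j ∧ w i + w j > t).card : ℝ) ≤
      (Finset.univ.filter fun j => w j ∈ Set.Ioi (t - w i)).card := by exact_mod_cast h1
  have h2' : ((Finset.univ.filter fun j => w j ∈ Set.Ioi (t - w i)).card : ℝ) ≤
      (Finset.univ.filter fun j => i ≠ j ∧ w i + w j > t).card + 1 := by exact_mod_cast h2
  rw [hdeg, Fintype.card_fin, Nat.cast_succ, ← sub_div, abs_div,
    abs_of_pos (by positivity : (0 : ℝ) < n + 1)]
  gcongr
  rw [abs_sub_le_iff]
  constructor <;> linarith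

variable {Ω : Type*} [MeasurableSpace Ω] {P : Measure Ω} {ρ : Measure ℝ} {X : ℕ → Ω → ℝ}

/-- Separability of `C(I, ℝ)` leaves countably many strong laws; an `ε / 3` argument covers the
other functions. -/
lemma ae_forall_continuousMap_tendsto [IsProbabilityMeasure ρ] (hlaw : ∀ i, HasLaw (X i) ρ P)
    (hindep : iIndepFun X P) {φ : ℝ → I} (hφ : Measurable φ) :
    ∀ᵐ ω ∂P, ∀ f : C(I, ℝ), Tendsto
      (fun n : ℕ => ∫ x, f (φ x) ∂(empirical fun i : Fin (n + 1) => X i ω)) atTop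
      (𝓝 (∫ x, f (φ x) ∂ρ)) := by
  have h := ae_all_iff.2 fun m : ℕ =>
    ae_tendsto_integral_empirical hlaw hindep
      (g := fun x => TopologicalSpace.denseSeq C(I, ℝ) m (φ x))
      ((map_continuous _).measurable.comp hφ)
      (C := ‖TopologicalSpace.denseSeq C(I, ℝ) m‖)
      fun x => (TopologicalSpace.denseSeq C(I, ℝ) m).norm_coe_le_norm (φ x)
  filter_upwards [h] with ω hω f
  have hint : ∀ (f : C(I, ℝ)) (μ : Measure ℝ) [IsProbabilityMeasure μ],
      Integrable (fun x => f (φ x)) μ := fun f μ _ =>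
    .of_bound ((map_continuous f).measurable.comp hφ).aestronglyMeasurable ‖f‖
      (ae_of_all _ fun x => f.norm_coe_le_norm _)
  refine Metric.tendsto_nhds.2 fun ε hε => ?_
  obtain ⟨m, hm⟩ := (TopologicalSpace.denseRange_denseSeq C(I, ℝ)).exists_dist_lt f
    (show 0 < ε / 3 by positivity)
  have hclose : ∀ (μ : Measure ℝ) [IsProbabilityMeasure μ],
      |∫ x, f (φ x) ∂μ - ∫ x, TopologicalSpace.denseSeq C(I, ℝ) m (φ x) ∂μ| ≤ ε / 3 :=
    fun μ _ => abs_integral_sub_integral_le (hint _ μ) (hint _ μ) fun x =>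
      (ContinuousMap.dist_apply_le_dist (φ x)).trans hm.le
  filter_upwards [Metric.tendsto_nhds.1 (hω m) (ε / 3) (by positivity)] with n hn
  have h1 := hclose (empirical fun i : Fin (n + 1) => X i ω)
  have h2 := hclose ρ
  rw [Real.dist_eq] at hn ⊢
  rw [abs_le] at h1 h2
  rw [abs_lt] at hn ⊢
  constructor <;> linarith

lemma tendsto_degreeDistribution [IsProbabilityMeasure ρ] (t : ℝ) {x : ℕ → ℝ}
    (hGC : ∀ ε > 0, ∀ᶠ n : ℕ in atTop, ∀ a,
      |cdf (empirical fun i : Fin (n + 1) => x i) a - cdf ρ a| ≤ ε)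
    (hf : ∀ f : C(I, ℝ), Tendsto
      (fun n : ℕ => ∫ y, f (upperTail ρ t y) ∂(empirical fun i : Fin (n + 1) => x i)) atTop
      (𝓝 (∫ y, f (upperTail ρ t y) ∂ρ))) :
    Tendsto (fun n : ℕ => degreeDistribution (weightGraph t (fun i : Fin (n + 1) => x i)))
      atTop (𝓝 (tailLaw ρ t)) := by
  refine ProbabilityMeasure.tendsto_iff_forall_integral_tendsto.2 fun f => ?_
  have hlim : ∫ y, f y ∂(tailLaw ρ t : Measure I) = ∫ y, f (upperTail ρ t y) ∂ρ :=
    integral_map (measurable_upperTail ρ t).aemeasurable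
      f.continuous.measurable.aestronglyMeasurable
  rw [hlim]
  have hdiff : Tendsto (fun n : ℕ =>
      ∫ y, f y ∂(degreeDistribution (weightGraph t (fun i : Fin (n + 1) => x i)) : Measure I) -
        ∫ y, f (upperTail ρ t y) ∂(empirical fun i : Fin (n + 1) => x i)) atTop (𝓝 0) := by
    refine Metric.tendsto_nhds.2 fun ε hε => ?_
    obtain ⟨δ, hδ, hfδ⟩ := Metric.uniformContinuous_iff.1
      (CompactSpace.uniformContinuous_of_continuous f.continuous) (ε / 2) (half_pos hε)
    -- Half of `δ` pays for `F_n` against `F`, the other half for the missing loop at `i`.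
    filter_upwards [hGC (δ / 2) (half_pos hδ),
      tendsto_one_div_add_atTop_nhds_zero_nat.eventually_lt_const (half_pos hδ)] with n hn hnδ
    have hν : (degreeDistribution (weightGraph t (fun i : Fin (n + 1) => x i)) : Measure I) =
        empirical (normDegree (weightGraph t (fun i : Fin (n + 1) => x i))) := rfl
    rw [hν, integral_empirical _ f.continuous.stronglyMeasurable,
      integral_empirical (g := fun y => f (upperTail ρ t y)) _ (f.continuous.measurable.comp
        (measurable_upperTail ρ t)).stronglyMeasurable, ← sub_div, ← Finset.sum_sub_distrib,
      dist_zero_right, norm_div, Fintype.card_fin, Real.norm_natCast,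
      div_lt_iff₀ (by positivity)]
    refine lt_of_le_of_lt (norm_sum_le_of_le (n := fun _ => ε / 2) _ fun i _ => ?_) ?_
    · refine (hfδ ?_).le
      rw [Subtype.dist_eq, Real.dist_eq]
      have h1 := abs_normDegree_sub_le t (fun i : Fin (n + 1) => x i) i
      have h2 := hn (t - x i)
      have h3 : ((upperTail ρ t (x i) : I) : ℝ) = 1 - cdf ρ (t - x i) := rfl
      rw [h3]
      rw [abs_le] at h1 h2
      rw [abs_lt]
      constructor <;> linarith
    · have : (0 : ℝ) < (n + 1 : ℕ) := by positivity
      simp only [Finset.sum_const, Finset.card_univ, Fintype.card_fin, nsmul_eq_mul]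
      nlinarith
  simpa using hdiff.add (hf ⟨f, f.continuous⟩)

end Degrees

/-! ### Homomorphism densities -/

section HomDensity

variable {k : ℕ}

/-- The weight vectors for which the identity map is a homomorphism into the threshold graph. -/
def homSet (t : ℝ) (F : SimpleGraph (Fin k)) : Set (Fin k → ℝ) :=
  {x | ∀ a b, F.Adj a b → t < x a + x b}

lemma isUpperSet_homSet (t : ℝ) (F : SimpleGraph (Fin k)) : IsUpperSet (homSet t F) :=
  fun _ _ hxy hx a b hab => (hx a b hab).trans_le (add_le_add (hxy a) (hxy b))

lemma measurableSet_homSet (t : ℝ) (F : SimpleGraph (Fin k)) : MeasurableSet (homSet t F) := by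
  simp only [homSet, Set.ofPred_forall]
  exact .iInter fun a => .iInter fun b => .iInter fun _ =>
    measurableSet_lt measurable_const (by fun_prop)

open Classical in
lemma card_not_injective (N : ℕ) :
    (Finset.univ.filter fun f : Fin k → Fin N => ¬ Function.Injective f).card =
      N ^ k - N.descFactorial k := by
  have h1 : (Finset.univ.filter fun f : Fin k → Fin N => Function.Injective f).card =
      N.descFactorial k := by
    rw [← Fintype.card_subtype,
      Fintype.card_congr (Equiv.subtypeInjectiveEquivEmbedding (Fin k) (Fin N)),
      Fintype.card_embedding_eq, Fintype.card_fin, Fintype.card_fin]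
  have h2 := Finset.card_filter_add_card_filter_not (s := Finset.univ)
    fun f : Fin k → Fin N => Function.Injective f
  simp only [Finset.card_univ, Fintype.card_fun, Fintype.card_fin] at h2
  omega

/-- Homomorphisms must also separate the ends of each edge, so the two counts disagree only on
non-injective maps, whose proportion is the right-hand side. -/
lemma abs_homDensity_sub_le (t : ℝ) (F : SimpleGraph (Fin k)) {n : ℕ} (w : Fin (n + 1) → ℝ) :
    |homDensity F (weightGraph t w) - (Measure.pi fun _ => empirical w).real (homSet t F)| ≤
      1 - ((n + 1).descFactorial k : ℝ) / ((n + 1 : ℕ) : ℝ) ^ k := by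
  classical
  rw [pi_empirical, empirical_real_apply _ (measurableSet_homSet t F)]
  let e : (F →g weightGraph t w) ≃
      {f : Fin k → Fin (n + 1) // ∀ a b, F.Adj a b → f a ≠ f b ∧ w (f a) + w (f b) > t} :=
    { toFun := fun φ => ⟨φ, fun a b h => φ.map_rel h⟩
      invFun := fun f => ⟨f.1, fun {a b} h => f.2 a b h⟩
      left_inv := fun _ => rfl
      right_inv := fun _ => rfl }
  rw [homDensity, Nat.card_congr e, Nat.card_eq_fintype_card, Fintype.card_subtype]
  set H := Finset.univ.filter fun f : Fin k → Fin (n + 1) =>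
    ∀ a b, F.Adj a b → f a ≠ f b ∧ w (f a) + w (f b) > t with hH
  set S := Finset.univ.filter fun f : Fin k → Fin (n + 1) => (fun i => w (f i)) ∈ homSet t F
    with hS
  have h1 : H.card ≤ S.card := Finset.card_le_card fun f => by
    simp only [hH, hS, Finset.mem_filter, Finset.mem_univ, true_and]
    exact fun h a b hab => (h a b hab).2
  have h2 : S.card ≤ H.card + ((n + 1) ^ k - (n + 1).descFactorial k) := by
    rw [← card_not_injective]
    refine (Finset.card_le_card fun f => ?_).trans (Finset.card_union_le _ _)
    simp only [hH, hS, Finset.mem_filter, Finset.mem_univ, true_and, Finset.mem_union]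
    intro h
    by_cases hf : Function.Injective f
    · exact Or.inl fun a b hab => ⟨fun he => hab.ne (hf he), h a b hab⟩
    · exact Or.inr hf
  have hle : (n + 1).descFactorial k ≤ (n + 1) ^ k := Nat.descFactorial_le_pow _ _
  have h1' : (H.card : ℝ) ≤ S.card := by exact_mod_cast h1
  have h2' : (S.card : ℝ) ≤ H.card + (((n + 1 : ℕ) : ℝ) ^ k - (n + 1).descFactorial k) := by
    have : (S.card : ℝ) ≤ (H.card + ((n + 1) ^ k - (n + 1).descFactorial k) : ℕ) := by
      exact_mod_cast h2
    rwa [Nat.cast_add, Nat.cast_sub hle, Nat.cast_pow] at this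
  have hpos : (0 : ℝ) < ((n + 1 : ℕ) : ℝ) ^ k := by positivity
  rw [Fintype.card_fun, Fintype.card_fin, Fintype.card_fin, Nat.cast_pow, ← sub_div, abs_div,
    abs_of_pos hpos, div_le_iff₀ hpos, sub_mul, one_mul, div_mul_cancel₀ _ hpos.ne',
    abs_sub_comm, abs_of_nonneg (by linarith)]
  linarith

lemma tendsto_one_sub_descFactorial_div_pow (k : ℕ) :
    Tendsto (fun n : ℕ => 1 - ((n + 1).descFactorial k : ℝ) / ((n + 1 : ℕ) : ℝ) ^ k) atTop
      (𝓝 0) := by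
  have h := (Asymptotics.isEquivalent_iff_tendsto_one
    (by filter_upwards [eventually_gt_atTop 0] with n hn; positivity)).1
    (isEquivalent_descFactorial k)
  simpa using (h.comp (tendsto_add_atTop_nat 1)).const_sub 1

variable (ρ : Measure ℝ) [IsProbabilityMeasure ρ] (t : ℝ)

lemma homDensity_limitGraphon (F : SimpleGraph (Fin k)) (hμ : IsSymmetric (tailLaw ρ t)) :
    (limitGraphon (tailLaw ρ t) hμ).homDensity F =
      (Measure.pi fun _ => ρ).real (homSet t F) := by
  classical
  have hpi : (Measure.pi fun _ : Fin k => ρ) =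
      (volume : Measure (Fin k → I)).map fun u i => realQuantile ρ (u i) := by
    have hq := (measurePreserving_realQuantile ρ)
    have : ∀ i : Fin k, SigmaFinite ((volume : Measure I).map (realQuantile ρ)) := fun _ => by
      rw [hq.map_eq]; infer_instance
    rw [volume_pi, Measure.pi_map_pi fun _ => hq.measurable.aemeasurable]
    simp only [hq.map_eq]
  have hmeas : Measurable fun (u : Fin k → I) i => realQuantile ρ (u i) :=
    measurable_pi_lambda _ fun i => (measurable_realQuantile ρ).comp (measurable_pi_apply i)
  rw [hpi, map_measureReal_apply hmeas (measurableSet_homSet t F),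
    ← integral_indicator_one (hmeas (measurableSet_homSet t F))]
  refine integral_congr_ae ?_
  filter_upwards [ae_mem_limitSet_tailLaw_iff ρ t (ι := Fin k)] with u hu
  have hcoe : ∀ p : I × I, ((limitGraphon (tailLaw ρ t) hμ).toFun p : ℝ) =
      if p ∈ limitSet (tailLaw ρ t) then 1 else 0 := fun p => by
    simp only [limitGraphon]
    split_ifs <;> simp
  simp only [hcoe]
  have hiff : (∀ e ∈ Finset.univ.filter (fun e : Fin k × Fin k => e.1 < e.2 ∧ F.Adj e.1 e.2),
      (u e.1, u e.2) ∈ limitSet (tailLaw ρ t)) ↔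
      u ∈ (fun (u : Fin k → I) i => realQuantile ρ (u i)) ⁻¹' homSet t F := by
    simp only [Finset.mem_filter, Finset.mem_univ, true_and, Prod.forall, homSet,
      Set.mem_preimage, Set.mem_ofPred_eq]
    refine ⟨fun h a b hab => ?_, fun h a b hab => (hu a b hab.2.ne).2 (h a b hab.2)⟩
    -- The product sees each edge once, in increasing order; commutativity of the sum recovers the
    -- other order.
    rcases hab.ne.lt_or_gt with hlt | hlt
    · exact (hu a b hab.ne).1 (h a b ⟨hlt, hab⟩)
    · rw [add_comm]
      exact (hu b a hab.ne').1 (h b a ⟨hlt, hab.symm⟩)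
  rw [Finset.prod_boole]
  by_cases h : u ∈ (fun (u : Fin k → I) i => realQuantile ρ (u i)) ⁻¹' homSet t F
  · rw [Set.indicator_of_mem h, Pi.one_apply]
    exact if_pos (hiff.2 h)
  · rw [Set.indicator_of_notMem h]
    exact if_neg (mt hiff.1 h)

variable {ρ}

lemma tendsto_pi_empirical_homSet {x : ℕ → ℝ}
    (hGC : ∀ ε > 0, ∀ᶠ n : ℕ in atTop, ∀ a,
      |cdf (empirical fun i : Fin (n + 1) => x i) a - cdf ρ a| ≤ ε) (F : SimpleGraph (Fin k)) :
    Tendsto (fun n : ℕ =>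
        (Measure.pi fun _ => empirical fun i : Fin (n + 1) => x i).real (homSet t F)) atTop
      (𝓝 ((Measure.pi fun _ => ρ).real (homSet t F))) := by
  refine Metric.tendsto_nhds.2 fun ε hε => ?_
  -- The denominator `k + 1` keeps the final inequality strict and allows `k = 0`.
  filter_upwards [hGC (ε / (k + 1)) (by positivity)] with n hn
  refine lt_of_le_of_lt (abs_pi_real_sub_le_of_isUpperSet hn (measurableSet_homSet t F)
    (isUpperSet_homSet t F)) ?_
  rw [mul_div_assoc', div_lt_iff₀ (by positivity)]
  linarith

lemma convergesTo_graphLimitOf {x : ℕ → ℝ}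
    (hGC : ∀ ε > 0, ∀ᶠ n : ℕ in atTop, ∀ a,
      |cdf (empirical fun i : Fin (n + 1) => x i) a - cdf ρ a| ≤ ε)
    (hμ : IsSymmetric (tailLaw ρ t)) :
    ConvergesTo (fun n : ℕ => weightGraph t (fun i : Fin (n + 1) => x i))
      (graphLimitOf (tailLaw ρ t) hμ) := by
  refine ⟨tendsto_add_atTop_nat 1, fun k F => ?_⟩
  have hlim : (graphLimitOf (tailLaw ρ t) hμ).homDensity F =
      (Measure.pi fun _ => ρ).real (homSet t F) := homDensity_limitGraphon ρ t F hμ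
  rw [hlim]
  have hdiff := squeeze_zero_norm (f := fun n : ℕ =>
      homDensity F (weightGraph t fun i : Fin (n + 1) => x i) -
        (Measure.pi fun _ => empirical fun i : Fin (n + 1) => x i).real (homSet t F))
    (fun n => abs_homDensity_sub_le t F fun i : Fin (n + 1) => x i)
    (tendsto_one_sub_descFactorial_div_pow k)
  simpa using hdiff.add (tendsto_pi_empirical_homSet t hGC F)

end HomDensity

/-! ### The laws of the two random graphs -/

section IdentDistrib

variable (t : ℝ)

lemma measurable_weightGraph (n : ℕ) :
    Measurable fun w : Fin n → ℝ => weightGraph t w := by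
  refine SimpleGraph.measurable_iff_adj.2 fun a b => measurableSet_setOfPred.1 ?_
  by_cases hab : a = b
  · simp [weightGraph, hab]
  · simpa [weightGraph, hab] using measurableSet_lt measurable_const
      ((measurable_pi_apply a).add (measurable_pi_apply b) : Measurable fun w : Fin n → ℝ => _)

variable (ρ : Measure ℝ)

/-- The real-valued quantile can be wrong only at `0` and `1`, which almost surely no coordinate
hits. -/
lemma ae_setGraph_weightSet_eq (n : ℕ) : ∀ᵐ u : Fin n → I,
    weightGraph t (fun i => realQuantile ρ (u i)) = setGraph (weightSet ρ t) u := by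
  have hIoo : ∀ᵐ u : Fin n → I, ∀ a, 0 < u a ∧ u a < 1 := ae_all_iff.2 fun a =>
    (measurePreserving_eval (fun _ : Fin n => (volume : Measure I)) a).quasiMeasurePreserving.ae
      ae_mem_Ioo_unitInterval
  filter_upwards [hIoo] with u hu
  ext a b
  simp only [setGraph, SimpleGraph.fromRel_adj, weightGraph,
    mem_weightSet_iff ρ t (hu _) (hu _), add_comm (realQuantile ρ (u b)), gt_iff_lt, ← or_and_right]
  refine and_congr_right fun hab => ?_
  simp [hab.lt_or_gt]

variable {ρ} [IsProbabilityMeasure ρ]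

lemma identDistrib_weightGraph_setGraph {Ω : Type*} [MeasurableSpace Ω] {P : Measure Ω}
    {X : ℕ → Ω → ℝ} (hlaw : ∀ i, HasLaw (X i) ρ P) (hindep : iIndepFun X P) (n : ℕ) :
    IdentDistrib (fun ω => weightGraph t (fun i : Fin n => X i ω))
      (fun u : Fin n → I => setGraph (weightSet ρ t) u) P volume := by
  have hX : HasLaw (fun ω (i : Fin n) => X i ω) (Measure.pi fun _ => ρ) P :=
    (hindep.precomp Fin.val_injective).hasLaw_pi fun i : Fin n => hlaw i
  have hq := measurePreserving_pi (fun _ : Fin n => (volume : Measure I)) (fun _ => ρ)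
    fun _ => measurePreserving_realQuantile ρ
  have h : IdentDistrib (fun ω (i : Fin n) => X i ω)
      (fun (u : Fin n → I) i => realQuantile ρ (u i)) P volume :=
    ⟨hX.aemeasurable, hq.measurable.aemeasurable, hX.map_eq.trans hq.map_eq.symm⟩
  exact (h.comp (measurable_weightGraph t n)).trans
    (.of_ae_eq ((measurable_weightGraph t n).comp hq.measurable).aemeasurable
      (ae_setGraph_weightSet_eq t ρ n))

end IdentDistrib

end ThresholdLimit

open ThresholdLimit in
theorem theorem6p3 {Ω : Type*} [MeasurableSpace Ω] (P : Measure Ω) [IsProbabilityMeasure P]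
    (ρ : Measure ℝ) [IsProbabilityMeasure ρ] (t : ℝ)
    (X : ℕ → Ω → ℝ) (hlaw : ∀ i, HasLaw (X i) ρ P) (hindep : iIndepFun X P) :
    -- the set `S` is symmetric and increasing
    (Prod.swap ⁻¹' weightSet ρ t = weightSet ρ t ∧ IsUpperSet (weightSet ρ t)) ∧
    -- `T_{n;X,t}` and `T_{n,S}` have the same law, for every `n`
    (∀ n : ℕ, IdentDistrib (fun ω => weightGraph t (fun i : Fin n => X i ω))
      (fun u : Fin n → I => setGraph (weightSet ρ t) u) P volume) ∧
    -- `μ [0, s] = P (1 - F (t - X) ≤ s)`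
    (∀ s : I, (tailLaw ρ t : Measure I) (Set.Icc 0 s) = ρ {x : ℝ | 1 - cdf ρ (t - x) ≤ s}) ∧
    -- `ν(T_{n;X,t}) → μ` a.s.; `μ` is symmetric, and `T_{n;X,t} → Γ_μ` a.s.
    (∀ᵐ ω ∂P, Tendsto
      (fun n : ℕ => degreeDistribution (weightGraph t (fun i : Fin (n + 1) => X i ω)))
      atTop (𝓝 (tailLaw ρ t))) ∧
    ∃ hμ : IsSymmetric (tailLaw ρ t),
      ∀ᵐ ω ∂P, ConvergesTo (fun n : ℕ => weightGraph t (fun i : Fin (n + 1) => X i ω))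
        (graphLimitOf (tailLaw ρ t) hμ) := by
  refine ⟨⟨swap_preimage_weightSet ρ t, isUpperSet_weightSet ρ t⟩,
    identDistrib_weightGraph_setGraph t hlaw hindep, fun s => ?_, ?_,
    isSymmetric_tailLaw ρ t, ?_⟩
  · change (ρ.map (upperTail ρ t)) (Set.Icc 0 s) = _
    rw [Measure.map_apply (measurable_upperTail ρ t) measurableSet_Icc]
    congr 1
    ext x
    exact ⟨fun h => h.2, fun h => ⟨(upperTail ρ t x).2.1, h⟩⟩
  · filter_upwards [glivenko_cantelli hlaw hindep,
      ae_forall_continuousMap_tendsto hlaw hindep (measurable_upperTail ρ t)] with ω h1 h2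
    exact tendsto_degreeDistribution t (x := fun i => X i ω) h1 h2
  · filter_upwards [glivenko_cantelli hlaw hindep] with ω h
    exact convergesTo_graphLimitOf t (x := fun i => X i ω) h _
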